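/- Let $(\mathcal A;\mathcal E)$ be an exact category (in the sense of Quillen; $\mathcal A$ is additive and $\mathcal E$ is the class of conflations $B\to C\to A$) with exact coproducts, i.e. all set-indexed coproducts exist in $\mathcal A$ and every coproduct of conflations is a conflation. Call morphisms $a:A_0\to A_1$ and $b:B_0\to B_1$ $\operatorname{Ext}$-orthogonal if the map $\operatorname{Ext}(a,b):\operatorname{Ext}(A_1,B_0)\to\operatorname{Ext}(A_0,B_1)$ (pushout along $b$ and pullback along $a$) is $0$. For a class $\mathcal M$ of morphisms let ${}^{\perp}\mathcal M$ (resp. $\mathcal M^{\perp}$) be the class of morphisms left (resp. right) $\operatorname{Ext}$-orthogonal to every morphism in $\mathcal M$; the left closure of $\mathcal M$ is ${}^{\perp}(\mathcal M^{\perp})$. A morphism is projective (resp. injective) if it is left (resp. right) $\operatorname{Ext}$-orthogonal to every morphism of $\mathcal A$. Assume that there are enough projective morphisms and enough injective morphisms: every object is the codomain of a projective morphism that is a deflation, and the domain of an injective morphism that is an inflation. An ideal of $\mathcal A$ is an additive subbifunctor of $\operatorname{Hom}$. An ideal cotorsion pair is a pair $(\mathcal I,\mathcal J)$ of ideals with $\mathcal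 I={}^{\perp}\mathcal J$ and $\mathcal J=\mathcal I^{\perp}$. It is complete if $\mathcal J$ is special preenveloping and $\mathcal I$ is special precovering. Here $\mathcal J$ is special preenveloping if for every object $B$ there is a morphism of conflations $$\begin{array}{ccccc} B&\xrightarrow{\;j\;}&C_0&\to&A_0\\ \|&&\downarrow&&\downarrow{\scriptstyle a}\\ B&\to&C_1&\to&A_1\end{array}$$ with $j\in\mathcal J$ and $a\in{}^{\perp}\mathcal J$; dually, $\mathcal I$ is special precovering if for every object $A$ there is a morphism of conflations $$\begin{array}{ccccc} B_0&\to&C_0&\to&A\\ {\scriptstyle b}\downarrow&&\downarrow&&\|\\ B_1&\to&C_1&\xrightarrow{\;i\;}&A\end{array}$$ with $i\in\mathcal I$ and $b\in\mathcal I^{\perp}$. Let $(\mathcal I_j,\mathcal I_j^{\perp})$, $j\in J$, be a family of complete ideal cotorsion pairs in $(\mathcal A;\mathcal E)$ indexed by a set $J$, and put $\mathcal J=\bigcap_{j\in J}\mathcal I_j^{\perp}$. Then $({}^{\perp}\mathcal J,\mathcal J)$ is a complete ideal cotorsion pair. Moreover, ${}^{\perp}\mathcal J$ is the left closure of $\sum_{j\in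 J}\mathcal I_j$, the ideal whose morphisms are the finite sums of parallel morphisms each belonging to some $\mathcal I_j$. -/

import Mathlib

open CategoryTheory CategoryTheory.Limits

universe w v u

namespace IdealApprox

variable {C : Type u} [Category.{v} C] [Preadditive C]

/-- `m` occurs as the first morphism of a short complex of the class `P`. -/
def IsFirstMap (P : ObjectProperty (ShortComplex C)) {X Y : C} (m : X ⟶ Y) : Prop :=
  ∃ (Z : C) (p : Y ⟶ Z) (h : m ≫ p = 0), P (ShortComplex.mk m p h)

/-- `p` occurs as the second morphism of a short complex of the class `P`. -/
def IsSecondMap (P : ObjectProperty (ShortComplex C)) {Y Z : C} (p : Y ⟶ Z) : Prop :=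
  ∃ (X : C) (m : X ⟶ Y) (h : m ≫ p = 0), P (ShortComplex.mk m p h)

/-- An exact structure in the sense of Quillen and Keller on a category `C`
(which is additive in all that follows): a class of kernel-cokernel pairs `B ⟶ C ⟶ A`, the
*conflations*, closed under isomorphism. The first morphism of a conflation is an *inflation*, the
second one a *deflation*; these satisfy the usual axioms. -/
structure ExactStructure (C : Type u) [Category.{v} C] [Preadditive C] where
  /-- the class of conflations -/
  conflation : ObjectProperty (ShortComplex C)
  of_iso : ∀ {S T : ShortComplex C}, (S ≅ T) → conflation S → conflation T
  isKernel : ∀ S : ShortComplex C, conflation S →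
    Nonempty (IsLimit (KernelFork.ofι S.f S.zero))
  isCokernel : ∀ S : ShortComplex C, conflation S →
    Nonempty (IsColimit (CokernelCofork.ofπ S.g S.zero))
  id_inflation : ∀ A : C, IsFirstMap conflation (𝟙 A)
  id_deflation : ∀ A : C, IsSecondMap conflation (𝟙 A)
  comp_inflation : ∀ {X Y Z : C} (m : X ⟶ Y) (n : Y ⟶ Z),
    IsFirstMap conflation m → IsFirstMap conflation n → IsFirstMap conflation (m ≫ n)
  comp_deflation : ∀ {X Y Z : C} (p : X ⟶ Y) (q : Y ⟶ Z),
    IsSecondMap conflation p → IsSecondMap conflation q → IsSecondMap conflation (p ≫ q)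
  pushout_inflation : ∀ {X Y X' : C} (m : X ⟶ Y) (f : X ⟶ X'), IsFirstMap conflation m →
    ∃ (Y' : C) (g : Y ⟶ Y') (m' : X' ⟶ Y'), IsPushout m f g m' ∧ IsFirstMap conflation m'
  pullback_deflation : ∀ {Y Z Z' : C} (p : Y ⟶ Z) (f : Z' ⟶ Z), IsSecondMap conflation p →
    ∃ (Y' : C) (g : Y' ⟶ Y) (p' : Y' ⟶ Z'), IsPullback g p' p f ∧ IsSecondMap conflation p'

namespace ExactStructure

variable (E : ExactStructure C)

/-- `m` is an inflation. -/
def IsInflation {X Y : C} (m : X ⟶ Y) : Prop := IsFirstMap E.conflation m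

/-- `p` is a deflation. -/
def IsDeflation {Y Z : C} (p : Y ⟶ Z) : Prop := IsSecondMap E.conflation p

/-! ### The functor `Ext` of an exact category -/

/-- An extension of `A` by `B`: a conflation `B ⟶ mid ⟶ A`. -/
structure Extension (A B : C) where
  /-- the middle object -/
  mid : C
  /-- the inflation -/
  m : B ⟶ mid
  /-- the deflation -/
  p : mid ⟶ A
  zero : m ≫ p = 0
  conf : E.conflation (ShortComplex.mk m p zero)

variable {E}

/-- Equivalence of extensions: an isomorphism of the middle terms that induces the identity
on both ends. -/
def Extension.Equivalent {A B : C} (ξ η : E.Extension A B) : Prop :=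
  ∃ e : ξ.mid ≅ η.mid, ξ.m ≫ e.hom = η.m ∧ e.hom ≫ η.p = ξ.p

variable (E) in
/-- Extensions of `A` by `B` up to equivalence. -/
instance extensionSetoid (A B : C) : Setoid (E.Extension A B) where
  r := Extension.Equivalent
  iseqv :=
    { refl := fun _ => ⟨Iso.refl _, by simp, by simp⟩
      symm := by
        rintro ξ η ⟨e, h₁, h₂⟩
        exact ⟨e.symm, by simp [← h₁], by simp [← h₂]⟩
      trans := by
        rintro ξ η θ ⟨e, h₁, h₂⟩ ⟨f, k₁, k₂⟩
        exact ⟨e ≪≫ f, by simp [reassoc_of% h₁, k₁], by simp [h₂, k₂]⟩ }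

variable (E) in
/-- `Ext (A, B)`: the equivalence classes of extensions of `A` by `B`. -/
def Ext (A B : C) : Type (max u v) := Quotient (E.extensionSetoid A B)

theorem Extension.exists_push {A B B' : C} (ξ : E.Extension A B) (b : B ⟶ B') :
    ∃ (η : E.Extension A B') (c : ξ.mid ⟶ η.mid), IsPushout ξ.m b c η.m ∧ c ≫ η.p = ξ.p := by
  obtain ⟨Y, c, m', sq, Z, q, hq, hconf⟩ :=
    E.pushout_inflation ξ.m b ⟨A, ξ.p, ξ.zero, ξ.conf⟩
  obtain ⟨cok⟩ := E.isCokernel _ ξ.conf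
  obtain ⟨cok'⟩ := E.isCokernel _ hconf
  let p' : Y ⟶ A := sq.desc ξ.p 0 (by simp [ξ.zero])
  have hc : c ≫ p' = ξ.p := sq.inl_desc _ _ _
  have hm : m' ≫ p' = 0 := sq.inr_desc _ _ _
  have hξ : ξ.m ≫ (c ≫ q) = 0 := by rw [← Category.assoc, sq.w, Category.assoc, hq, comp_zero]
  let s : Z ⟶ A := cok'.desc (CokernelCofork.ofπ p' hm)
  let t : A ⟶ Z := cok.desc (CokernelCofork.ofπ (c ≫ q) hξ)
  have hs : q ≫ s = p' := cok'.fac (CokernelCofork.ofπ p' hm) WalkingParallelPair.one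
  have ht : ξ.p ≫ t = c ≫ q := cok.fac (CokernelCofork.ofπ (c ≫ q) hξ) WalkingParallelPair.one
  have hp't : p' ≫ t = q := by
    apply sq.hom_ext
    · rw [reassoc_of% hc, ht]
    · rw [reassoc_of% hm, zero_comp, hq]
  have hst : s ≫ t = 𝟙 Z := Cofork.IsColimit.hom_ext cok' (by
    change q ≫ s ≫ t = q ≫ 𝟙 Z
    rw [reassoc_of% hs, hp't, Category.comp_id])
  have hts : t ≫ s = 𝟙 A := Cofork.IsColimit.hom_ext cok (by
    change ξ.p ≫ t ≫ s = ξ.p ≫ 𝟙 A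
    rw [reassoc_of% ht, hs, hc, Category.comp_id])
  let e : Z ≅ A := ⟨s, t, hst, hts⟩
  let i : ShortComplex.mk m' q hq ≅ ShortComplex.mk m' p' hm :=
    ShortComplex.isoMk (Iso.refl _) (Iso.refl _) e (by simp) (by simpa [e] using hs.symm)
  exact ⟨⟨Y, m', p', hm, E.of_iso i hconf⟩, c, sq, hc⟩

theorem Extension.exists_pull {A A' B : C} (ξ : E.Extension A B) (a : A' ⟶ A) :
    ∃ (η : E.Extension A' B) (c : η.mid ⟶ ξ.mid), IsPullback c η.p ξ.p a ∧ η.m ≫ c = ξ.m := by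
  obtain ⟨Y, c, p', sq, Z, q, hq, hconf⟩ :=
    E.pullback_deflation ξ.p a ⟨B, ξ.m, ξ.zero, ξ.conf⟩
  obtain ⟨ker⟩ := E.isKernel _ ξ.conf
  obtain ⟨ker'⟩ := E.isKernel _ hconf
  let m' : B ⟶ Y := sq.lift ξ.m 0 (by simp [ξ.zero])
  have hc : m' ≫ c = ξ.m := sq.lift_fst _ _ _
  have hm : m' ≫ p' = 0 := sq.lift_snd _ _ _
  have hξ : (q ≫ c) ≫ ξ.p = 0 := by rw [Category.assoc, sq.w, reassoc_of% hq, zero_comp]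
  let s : B ⟶ Z := ker'.lift (KernelFork.ofι m' hm)
  let t : Z ⟶ B := ker.lift (KernelFork.ofι (q ≫ c) hξ)
  have hs : s ≫ q = m' := ker'.fac (KernelFork.ofι m' hm) WalkingParallelPair.zero
  have ht : t ≫ ξ.m = q ≫ c := ker.fac (KernelFork.ofι (q ≫ c) hξ) WalkingParallelPair.zero
  have htm : t ≫ m' = q := by
    apply sq.hom_ext
    · rw [Category.assoc, hc, ht]
    · rw [Category.assoc, hm, comp_zero, hq]
  have hts : t ≫ s = 𝟙 Z := Fork.IsLimit.hom_ext ker' (by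
    change (t ≫ s) ≫ q = 𝟙 Z ≫ q
    rw [Category.assoc, hs, htm, Category.id_comp])
  have hst : s ≫ t = 𝟙 B := Fork.IsLimit.hom_ext ker (by
    change (s ≫ t) ≫ ξ.m = 𝟙 B ≫ ξ.m
    rw [Category.assoc, ht, reassoc_of% hs, hc, Category.id_comp])
  let e : Z ≅ B := ⟨t, s, hts, hst⟩
  let i : ShortComplex.mk q p' hq ≅ ShortComplex.mk m' p' hm :=
    ShortComplex.isoMk e (Iso.refl _) (Iso.refl _) (by simpa [e] using htm) (by simp)
  exact ⟨⟨Y, m', p', hm, E.of_iso i hconf⟩, c, sq, hc⟩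

theorem Extension.push_unique {A B B' : C} {ξ ξ' : E.Extension A B} {b : B ⟶ B'}
    (h : ξ.Equivalent ξ') {η η' : E.Extension A B'} {c : ξ.mid ⟶ η.mid} {c' : ξ'.mid ⟶ η'.mid}
    (sq : IsPushout ξ.m b c η.m) (hc : c ≫ η.p = ξ.p)
    (sq' : IsPushout ξ'.m b c' η'.m) (hc' : c' ≫ η'.p = ξ'.p) : η.Equivalent η' := by
  obtain ⟨e, h₁, h₂⟩ := h
  have sq'' : IsPushout ξ.m b (e.hom ≫ c') η'.m :=
    sq'.of_iso (Iso.refl _) e.symm (Iso.refl _) (Iso.refl _) (by simp [← h₁]) (by simp)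
      (by simp) (by simp)
  refine ⟨sq.isoIsPushout _ _ sq'', sq.inr_isoIsPushout_hom _ _ sq'', ?_⟩
  apply sq.hom_ext
  · rw [← Category.assoc, sq.inl_isoIsPushout_hom, Category.assoc, hc', h₂, hc]
  · rw [← Category.assoc, sq.inr_isoIsPushout_hom, η'.zero, η.zero]

theorem Extension.pull_unique {A A' B : C} {ξ ξ' : E.Extension A B} {a : A' ⟶ A}
    (h : ξ.Equivalent ξ') {η η' : E.Extension A' B} {c : η.mid ⟶ ξ.mid} {c' : η'.mid ⟶ ξ'.mid}
    (sq : IsPullback c η.p ξ.p a) (hc : η.m ≫ c = ξ.m)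
    (sq' : IsPullback c' η'.p ξ'.p a) (hc' : η'.m ≫ c' = ξ'.m) : η.Equivalent η' := by
  obtain ⟨e, h₁, h₂⟩ := h
  have sq'' : IsPullback (c ≫ e.hom) η.p ξ'.p a :=
    sq.of_iso (Iso.refl _) e (Iso.refl _) (Iso.refl _) (by simp) (by simp) (by simp [h₂])
      (by simp)
  refine ⟨sq''.isoIsPullback _ _ sq', ?_, sq''.isoIsPullback_hom_snd _ _ sq'⟩
  apply sq'.hom_ext
  · rw [Category.assoc, sq''.isoIsPullback_hom_fst, hc', reassoc_of% hc, h₁]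
  · rw [Category.assoc, sq''.isoIsPullback_hom_snd, η'.zero, η.zero]

/-- The pushout of the extension `ξ` of `A` by `B` along `b : B ⟶ B'`. -/
noncomputable def Extension.push {A B B' : C} (ξ : E.Extension A B) (b : B ⟶ B') :
    E.Extension A B' :=
  (ξ.exists_push b).choose

theorem Extension.push_spec {A B B' : C} (ξ : E.Extension A B) (b : B ⟶ B') :
    ∃ c : ξ.mid ⟶ (ξ.push b).mid, IsPushout ξ.m b c (ξ.push b).m ∧ c ≫ (ξ.push b).p = ξ.p :=
  (ξ.exists_push b).choose_spec

/-- The pullback of the extension `ξ` of `A` by `B` along `a : A' ⟶ A`. -/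
noncomputable def Extension.pull {A A' B : C} (ξ : E.Extension A B) (a : A' ⟶ A) :
    E.Extension A' B :=
  (ξ.exists_pull a).choose

theorem Extension.pull_spec {A A' B : C} (ξ : E.Extension A B) (a : A' ⟶ A) :
    ∃ c : (ξ.pull a).mid ⟶ ξ.mid, IsPullback c (ξ.pull a).p ξ.p a ∧ (ξ.pull a).m ≫ c = ξ.m :=
  (ξ.exists_pull a).choose_spec

/-- The map `Ext (A, b) : Ext (A, B) ⟶ Ext (A, B')`, given by pushout along `b`. -/
noncomputable def Ext.push {A B B' : C} (b : B ⟶ B') : E.Ext A B → E.Ext A B' :=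
  Quotient.map (fun ξ => ξ.push b) (fun ξ ξ' h => by
    obtain ⟨_, s₁, s₂⟩ := ξ.push_spec b
    obtain ⟨_, t₁, t₂⟩ := ξ'.push_spec b
    exact Extension.push_unique h s₁ s₂ t₁ t₂)

/-- The map `Ext (a, B) : Ext (A, B) ⟶ Ext (A', B)`, given by pullback along `a`. -/
noncomputable def Ext.pull {A A' B : C} (a : A' ⟶ A) : E.Ext A B → E.Ext A' B :=
  Quotient.map (fun ξ => ξ.pull a) (fun ξ ξ' h => by
    obtain ⟨_, s₁, s₂⟩ := ξ.pull_spec a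
    obtain ⟨_, t₁, t₂⟩ := ξ'.pull_spec a
    exact Extension.pull_unique h s₁ s₂ t₁ t₂)

variable [HasBinaryBiproducts C]

variable (E) in
theorem conflation_biprod (A B : C) :
    E.conflation (ShortComplex.mk (biprod.inl : B ⟶ B ⊞ A) biprod.snd (by simp)) := by
  obtain ⟨Z, m, hm, hconf⟩ := E.id_deflation A
  have hm0 : m = 0 := by simpa using hm
  obtain ⟨ker⟩ := E.isKernel _ hconf
  have hZ : 𝟙 Z = 0 := Fork.IsLimit.hom_ext ker (by
    change 𝟙 Z ≫ m = 0 ≫ m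
    simp [hm0])
  let ζ : E.Extension A Z := ⟨A, m, 𝟙 A, hm, hconf⟩
  obtain ⟨η, c, sq, hc⟩ := ζ.exists_push (0 : Z ⟶ B)
  have hcp : c ≫ η.p = 𝟙 A := hc
  let r : η.mid ⟶ B := sq.desc 0 (𝟙 B) (by simp)
  have hr₁ : c ≫ r = 0 := sq.inl_desc _ _ _
  have hr₂ : η.m ≫ r = 𝟙 B := sq.inr_desc _ _ _
  let e : η.mid ≅ B ⊞ A :=
    { hom := biprod.lift r η.p
      inv := biprod.desc η.m c
      hom_inv_id := by
        apply sq.hom_ext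
        · simp only [biprod.lift_desc, Preadditive.comp_add, reassoc_of% hr₁, reassoc_of% hcp]
          rw [zero_comp, zero_add]
          exact (Category.id_comp c).trans (Category.comp_id c).symm
        · simp [biprod.lift_desc, reassoc_of% hr₂, reassoc_of% η.zero]
      inv_hom_id := by
        apply biprod.hom_ext' <;> apply biprod.hom_ext <;> simp [hr₁, hr₂, hcp, η.zero] }
  let i : ShortComplex.mk η.m η.p η.zero ≅
      ShortComplex.mk (biprod.inl : B ⟶ B ⊞ A) biprod.snd (by simp) :=
    ShortComplex.isoMk (Iso.refl _) e (Iso.refl _)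
      (by apply biprod.hom_ext <;> simp [e, hr₂, η.zero]) (by simp [e])
  exact E.of_iso i η.conf

variable (E) in
/-- The split extension `B ⟶ B ⊞ A ⟶ A`. -/
noncomputable def splitExtension (A B : C) : E.Extension A B :=
  ⟨B ⊞ A, biprod.inl, biprod.snd, by simp, E.conflation_biprod A B⟩

/-- The zero element of the abelian group `Ext (A, B)`: the class of the split extension. -/
noncomputable instance (A B : C) : Zero (E.Ext A B) :=
  ⟨Quotient.mk _ (E.splitExtension A B)⟩

/-! ### Ext-orthogonality, ideals and cotorsion pairs -/

variable (E)

/-- The morphisms `a : A₀ ⟶ A₁` and `b : B₀ ⟶ B₁` are `Ext`-orthogonal: the map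
`Ext (a, b) = Ext (a, B₁) ∘ Ext (A₁, b) : Ext (A₁, B₀) ⟶ Ext (A₀, B₁)` is zero. -/
def ExtOrthogonal {A₀ A₁ B₀ B₁ : C} (a : A₀ ⟶ A₁) (b : B₀ ⟶ B₁) : Prop :=
  ∀ ξ : E.Ext A₁ B₀, Ext.pull a (Ext.push b ξ) = 0

/-- The class `ᗮM` of the morphisms left `Ext`-orthogonal to every morphism of the class `M`. -/
def leftPerp (M : MorphismProperty C) : MorphismProperty C :=
  fun _ _ a => ∀ ⦃B₀ B₁ : C⦄ (b : B₀ ⟶ B₁), M b → E.ExtOrthogonal a b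

/-- The class `Mᗮ` of the morphisms right `Ext`-orthogonal to every morphism of the class `M`. -/
def rightPerp (M : MorphismProperty C) : MorphismProperty C :=
  fun _ _ b => ∀ ⦃A₀ A₁ : C⦄ (a : A₀ ⟶ A₁), M a → E.ExtOrthogonal a b

/-- The left closure `ᗮ(Mᗮ)` of a class of morphisms. -/
def leftClosure (M : MorphismProperty C) : MorphismProperty C :=
  E.leftPerp (E.rightPerp M)

end ExactStructure

/-- A class of morphisms of a preadditive category is an ideal if it is an additive subbifunctor
of `Hom`. -/
structure IsIdeal (I : MorphismProperty C) : Prop where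
  zero_mem : ∀ X Y : C, I (0 : X ⟶ Y)
  add_mem : ∀ {X Y : C} (f g : X ⟶ Y), I f → I g → I (f + g)
  neg_mem : ∀ {X Y : C} (f : X ⟶ Y), I f → I (-f)
  comp_mem : ∀ {W X Y Z : C} (h : W ⟶ X) (g : X ⟶ Y) (f : Y ⟶ Z), I g → I (h ≫ g ≫ f)

/-- The sum of a family of ideals: its morphisms are the finite sums of (parallel) morphisms each
of which belongs to one of the ideals. -/
def idealSum {J : Type w} (I : J → MorphismProperty C) : MorphismProperty C :=
  fun X Y f => f ∈ AddSubgroup.closure {g : X ⟶ Y | ∃ j, I j g}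

namespace ExactStructure

variable [HasBinaryBiproducts C] (E : ExactStructure C)

/-- An ideal cotorsion pair. -/
structure IsCotorsionPair (I J : MorphismProperty C) : Prop where
  left_isIdeal : IsIdeal I
  right_isIdeal : IsIdeal J
  left_eq : I = E.leftPerp J
  right_eq : J = E.rightPerp I

/-- `j : B ⟶ C₀` is a special `J`-preenvelope: it belongs to `J` and occurs in a morphism
of conflations from `B ⟶ C₀ ⟶ A₀` (with inflation `j`) to `B ⟶ C₁ ⟶ A₁`, of the form
`(𝟙 B, c, a)` with `a` in `ᗮJ`. -/
def IsSpecialPreenvelope (J : MorphismProperty C) {B C₀ : C} (j : B ⟶ C₀) : Prop :=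
  J j ∧ ∃ (A₀ C₁ A₁ : C) (p₀ : C₀ ⟶ A₀) (m₁ : B ⟶ C₁) (p₁ : C₁ ⟶ A₁)
    (h₀ : j ≫ p₀ = 0) (h₁ : m₁ ≫ p₁ = 0) (c : C₀ ⟶ C₁) (a : A₀ ⟶ A₁),
    E.conflation (ShortComplex.mk j p₀ h₀) ∧ E.conflation (ShortComplex.mk m₁ p₁ h₁) ∧
      j ≫ c = m₁ ∧ p₀ ≫ a = c ≫ p₁ ∧ E.leftPerp J a

/-- `i : C₁ ⟶ A` is a special `I`-precover: it belongs to `I` and occurs in a morphism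
of conflations from `B₀ ⟶ C₀ ⟶ A` to `B₁ ⟶ C₁ ⟶ A` (with deflation `i`), of the form
`(b, c, 𝟙 A)` with `b` in `Iᗮ`. -/
def IsSpecialPrecover (I : MorphismProperty C) {C₁ A : C} (i : C₁ ⟶ A) : Prop :=
  I i ∧ ∃ (B₀ C₀ B₁ : C) (m₀ : B₀ ⟶ C₀) (p₀ : C₀ ⟶ A) (m₁ : B₁ ⟶ C₁)
    (h₀ : m₀ ≫ p₀ = 0) (h₁ : m₁ ≫ i = 0) (b : B₀ ⟶ B₁) (c : C₀ ⟶ C₁),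
    E.conflation (ShortComplex.mk m₀ p₀ h₀) ∧ E.conflation (ShortComplex.mk m₁ i h₁) ∧
      m₀ ≫ c = b ≫ m₁ ∧ c ≫ i = p₀ ∧ E.rightPerp I b

/-- Every object has a special `J`-preenvelope. -/
def IsSpecialPreenveloping (J : MorphismProperty C) : Prop :=
  ∀ B : C, ∃ (C₀ : C) (j : B ⟶ C₀), E.IsSpecialPreenvelope J j

/-- Every object has a special `I`-precover. -/
def IsSpecialPrecovering (I : MorphismProperty C) : Prop :=
  ∀ A : C, ∃ (C₁ : C) (i : C₁ ⟶ A), E.IsSpecialPrecover I i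

/-- A complete ideal cotorsion pair. -/
structure IsCompleteCotorsionPair (I J : MorphismProperty C) : Prop where
  isCotorsionPair : E.IsCotorsionPair I J
  isSpecialPrecovering : E.IsSpecialPrecovering I
  isSpecialPreenveloping : E.IsSpecialPreenveloping J

/-- A projective morphism: one left `Ext`-orthogonal to every morphism. -/
def IsProjectiveMorphism {X Y : C} (p : X ⟶ Y) : Prop :=
  ∀ ⦃B₀ B₁ : C⦄ (b : B₀ ⟶ B₁), E.ExtOrthogonal p b

/-- An injective morphism: one right `Ext`-orthogonal to every morphism. -/
def IsInjectiveMorphism {X Y : C} (e : X ⟶ Y) : Prop :=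
  ∀ ⦃A₀ A₁ : C⦄ (a : A₀ ⟶ A₁), E.ExtOrthogonal a e

/-- Every object is the codomain of a projective morphism that is a deflation. (Without the last
clause the condition would be void, since every morphism `0 : 0 ⟶ A` is projective.) -/
def EnoughProjectiveMorphisms : Prop :=
  ∀ A : C, ∃ (P : C) (p : P ⟶ A), E.IsProjectiveMorphism p ∧ E.IsDeflation p

/-- Every object is the domain of an injective morphism that is an inflation. -/
def EnoughInjectiveMorphisms : Prop :=
  ∀ B : C, ∃ (Q : C) (e : B ⟶ Q), E.IsInjectiveMorphism e ∧ E.IsInflation e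

end ExactStructure

/-- The coproduct of a family of short complexes. -/
noncomputable def coproductComplex [HasCoproducts.{w} C] {ι : Type w} (S : ι → ShortComplex C) :
    ShortComplex C :=
  ShortComplex.mk (Limits.Sigma.map fun i => (S i).f) (Limits.Sigma.map fun i => (S i).g)
    (by ext i; simp)

/-- Coproducts (of families indexed by types of the universe `w`) exist, and a coproduct of
conflations is a conflation. -/
structure ExactStructure.HasExactCoproducts (E : ExactStructure C) : Prop where
  hasCoproducts : HasCoproducts.{w} C
  conflation_coproduct : ∀ {ι : Type w} (S : ι → ShortComplex C),
    (∀ i, E.conflation (S i)) → E.conflation (coproductComplex S)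

end IdealApprox

namespace IdealApprox

variable {C : Type u} [Category.{v} C] [Preadditive C]

namespace ExactStructure

variable {E : ExactStructure C}

/-! ### Diagram lemmas for conflations -/

namespace Extension

/-! A morphism is right orthogonal to every `I j` exactly when it is right orthogonal to their sum.
So the intersection is a right perpendicular class, and the Galois connection between left and right
perpendiculars gives both the cotorsion pair and the description as a left closure. Completeness is
the real content.

Special preenvelopes (`isSpecialPreenveloping_iInf`): take the coproduct of the special preenvelope
diagrams of `B`, one for each index, and push it out along the codiagonal `∐ B ⟶ B`. The new
inflation out of `B` factors through each given preenvelope, hence lies in every ideal. On cokernels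
the diagram is the coproduct of the given maps, which is still left orthogonal to the intersection.

Special precovers then follow from an ideal version of Salce's lemma, using projective deflations.
Orthogonality is handled throughout as a lifting or an extension problem, so the group structure of
`Ext` plays no role. -/

theorem mono_m {A B : C} (ξ : E.Extension A B) : Mono ξ.m := by
  obtain ⟨ker⟩ := E.isKernel _ ξ.conf
  exact ⟨fun g h w => Fork.IsLimit.hom_ext ker w⟩

theorem epi_p {A B : C} (ξ : E.Extension A B) : Epi ξ.p := by
  obtain ⟨cok⟩ := E.isCokernel _ ξ.conf
  exact ⟨fun g h w => Cofork.IsColimit.hom_ext cok w⟩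

theorem exists_lift {A B X : C} (ξ : E.Extension A B) (f : X ⟶ ξ.mid) (hf : f ≫ ξ.p = 0) :
    ∃ g : X ⟶ B, g ≫ ξ.m = f := by
  obtain ⟨ker⟩ := E.isKernel _ ξ.conf
  exact ⟨ker.lift (KernelFork.ofι f hf),
    ker.fac (KernelFork.ofι f hf) WalkingParallelPair.zero⟩

theorem exists_desc {A B X : C} (ξ : E.Extension A B) (f : ξ.mid ⟶ X) (hf : ξ.m ≫ f = 0) :
    ∃ g : A ⟶ X, ξ.p ≫ g = f := by
  obtain ⟨cok⟩ := E.isCokernel _ ξ.conf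
  exact ⟨cok.desc (CokernelCofork.ofπ f hf),
    cok.fac (CokernelCofork.ofπ f hf) WalkingParallelPair.one⟩

/-- In a morphism `(b, c, a)` of conflations, `a` lifts along the second deflation if and only if
`b` extends along the first inflation. -/
theorem lifts_iff_extends {A A' B B' : C} {ξ : E.Extension A B} {η : E.Extension A' B'}
    {b : B ⟶ B'} {c : ξ.mid ⟶ η.mid} {a : A ⟶ A'}
    (hb : ξ.m ≫ c = b ≫ η.m) (ha : c ≫ η.p = ξ.p ≫ a) :
    (∃ t : A ⟶ η.mid, t ≫ η.p = a) ↔ ∃ r : ξ.mid ⟶ B', ξ.m ≫ r = b := by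
  have := η.mono_m
  have := ξ.epi_p
  constructor
  · rintro ⟨t, ht⟩
    obtain ⟨r, hr⟩ := η.exists_lift (c - ξ.p ≫ t) (by simp [ha, ht])
    refine ⟨r, ?_⟩
    rw [← cancel_mono η.m, Category.assoc, hr, Preadditive.comp_sub, hb, ← Category.assoc, ξ.zero,
      zero_comp, sub_zero]
  · rintro ⟨r, hr⟩
    obtain ⟨t, ht⟩ := ξ.exists_desc (c - r ≫ η.m) (by simp [hb, reassoc_of% hr])
    refine ⟨t, ?_⟩
    rw [← cancel_epi ξ.p, ← Category.assoc, ht, Preadditive.sub_comp, ha, Category.assoc, η.zero,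
      comp_zero, sub_zero]

/-- Exactness of `Ext (A, B) ⟶ Ext (X, B) ⟶ Ext (P, B)` for a conflation `P ⟶ X ⟶ A`: an extension
of `X` by `B` over which the inflation lifts is a pullback of an extension of `A` by `B`. -/
theorem exists_of_lifts {A P B : C} (θ : E.Extension A P)
    (ξ : E.Extension θ.mid B) (s : P ⟶ ξ.mid) (hs : s ≫ ξ.p = θ.m) :
    ∃ (ζ : E.Extension A B) (c : ξ.mid ⟶ ζ.mid), ξ.m ≫ c = ζ.m ∧ c ≫ ζ.p = ξ.p ≫ θ.p := by
  -- The kernel `L` of the composite deflation plays the role of an extension of `P` by `B`, which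
  -- `s` splits. The resulting retraction `f : L ⟶ B` is what the composite conflation is pushed out
  -- along.
  obtain ⟨L, l, hl, hconf⟩ := E.comp_deflation ξ.p θ.p ⟨_, _, _, ξ.conf⟩ ⟨_, _, _, θ.conf⟩
  let κ : E.Extension A L := ⟨ξ.mid, l, ξ.p ≫ θ.p, hl, hconf⟩
  have := θ.mono_m
  have := ξ.mono_m
  obtain ⟨q, hq⟩ := θ.exists_lift (l ≫ ξ.p) (by simpa using hl)
  obtain ⟨f, hf⟩ := ξ.exists_lift (l - q ≫ s) (by simp [hs, hq])
  obtain ⟨n, hn⟩ := κ.exists_lift ξ.m (by simp [κ, reassoc_of% ξ.zero])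
  replace hn : n ≫ l = ξ.m := hn
  have hnq : n ≫ q = 0 := by
    rw [← cancel_mono θ.m, Category.assoc, hq, reassoc_of% hn, ξ.zero, zero_comp]
  have hnf : n ≫ f = 𝟙 B := by
    rw [← cancel_mono ξ.m, Category.assoc, hf]
    simp [hn, reassoc_of% hnq]
  obtain ⟨ζ, c, sq, hc⟩ := κ.exists_push f
  refine ⟨ζ, c, ?_, hc⟩
  have hw : l ≫ c = f ≫ ζ.m := sq.w
  exact (by rw [← hn, Category.assoc, hw, reassoc_of% hnf] : ξ.m ≫ c = ζ.m)

theorem mk_eq_zero_iff [HasBinaryBiproducts C] {A B : C} (ξ : E.Extension A B) :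
    @Eq (E.Ext A B) (Quotient.mk _ ξ) 0 ↔ ∃ s : A ⟶ ξ.mid, s ≫ ξ.p = 𝟙 A := by
  have := ξ.mono_m
  constructor
  · intro h
    obtain ⟨e, -, h₂⟩ := Quotient.exact (show (Quotient.mk _ ξ : Quotient (E.extensionSetoid A B)) =
      Quotient.mk _ (E.splitExtension A B) from h)
    let σ : A ⟶ (E.splitExtension A B).mid := (biprod.inr : A ⟶ B ⊞ A)
    have hσ : σ ≫ (E.splitExtension A B).p = 𝟙 A := biprod.inr_snd
    exact ⟨σ ≫ e.inv, by rw [← h₂, Category.assoc, e.inv_hom_id_assoc, hσ]⟩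
  · rintro ⟨s, hs⟩
    obtain ⟨r, hr⟩ := ξ.exists_lift (𝟙 _ - ξ.p ≫ s) (by simp [hs])
    have hmr : ξ.m ≫ r = 𝟙 B := by
      rw [← cancel_mono ξ.m, Category.assoc, hr]
      simp [reassoc_of% ξ.zero]
    have hsr : s ≫ r = 0 := by
      rw [← cancel_mono ξ.m, Category.assoc, hr]
      simp [reassoc_of% hs]
    let e : ξ.mid ≅ B ⊞ A :=
      { hom := biprod.lift r ξ.p
        inv := biprod.desc ξ.m s
        hom_inv_id := by simp [biprod.lift_desc, hr]
        inv_hom_id := by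
          apply biprod.hom_ext' <;> apply biprod.hom_ext <;> simp [hmr, hsr, hs, ξ.zero] }
    have h₁ : ξ.m ≫ e.hom = biprod.inl := by
      apply biprod.hom_ext <;> simp [e, hmr, ξ.zero]
    have h₂ : e.hom ≫ biprod.snd = ξ.p := biprod.lift_snd _ _
    exact Quotient.sound (s := E.extensionSetoid A B) (b := E.splitExtension A B) ⟨e, h₁, h₂⟩

end Extension

/-! ### Orthogonality as a lifting or extension property -/

variable [HasBinaryBiproducts C]

/-- By the universal property of the pullback, a section of the pullback along `a` is the same as a
lift of `a`. -/
theorem extOrthogonal_iff_lifts {A₀ A₁ B₀ B₁ : C} {a : A₀ ⟶ A₁} {b : B₀ ⟶ B₁} :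
    E.ExtOrthogonal a b ↔
      ∀ ξ : E.Extension A₁ B₀, ∃ t : A₀ ⟶ (ξ.push b).mid, t ≫ (ξ.push b).p = a := by
  have key (ξ : E.Extension A₁ B₀) :
      Ext.pull a (Ext.push b (Quotient.mk _ ξ : E.Ext A₁ B₀)) = 0 ↔
        ∃ t : A₀ ⟶ (ξ.push b).mid, t ≫ (ξ.push b).p = a := by
    obtain ⟨c, sq, -⟩ := (ξ.push b).pull_spec a
    refine ((ξ.push b).pull a).mk_eq_zero_iff.trans ⟨?_, ?_⟩
    · rintro ⟨s, hs⟩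
      exact ⟨s ≫ c, by rw [Category.assoc, sq.w, reassoc_of% hs]⟩
    · rintro ⟨t, ht⟩
      exact ⟨sq.lift t (𝟙 _) (by simp [ht]), sq.lift_snd _ _ _⟩
  exact ⟨fun h ξ => (key ξ).1 (h _), fun h ξ => Quotient.inductionOn ξ fun ξ => (key ξ).2 (h ξ)⟩

theorem extOrthogonal_iff_extends {A₀ A₁ B₀ B₁ : C} {a : A₀ ⟶ A₁} {b : B₀ ⟶ B₁} :
    E.ExtOrthogonal a b ↔
      ∀ ξ : E.Extension A₁ B₀, ∃ r : (ξ.pull a).mid ⟶ B₁, (ξ.pull a).m ≫ r = b := by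
  rw [extOrthogonal_iff_lifts]
  refine forall_congr' fun ξ => ?_
  obtain ⟨c, sq, hc⟩ := ξ.push_spec b
  obtain ⟨d, sq', hd⟩ := ξ.pull_spec a
  exact Extension.lifts_iff_extends (c := d ≫ c) (by rw [reassoc_of% hd, sq.w])
    (by rw [Category.assoc, hc, sq'.w])

/-- A morphism of conflations starting with `b` factors through the pushout along `b`. This allows
any convenient diagram to be used, without identifying iterated pushouts and pullbacks. -/
theorem ExtOrthogonal.exists_lift {A₀ A₁ A₂ B₀ B₁ : C} {a : A₀ ⟶ A₁} {b : B₀ ⟶ B₁}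
    (h : E.ExtOrthogonal a b) {ξ : E.Extension A₁ B₀} {η : E.Extension A₂ B₁}
    {c : ξ.mid ⟶ η.mid} {f : A₁ ⟶ A₂} (hb : ξ.m ≫ c = b ≫ η.m) (hf : c ≫ η.p = ξ.p ≫ f) :
    ∃ t : A₀ ⟶ η.mid, t ≫ η.p = a ≫ f := by
  obtain ⟨t, ht⟩ := extOrthogonal_iff_lifts.1 h ξ
  obtain ⟨d, sq, hd⟩ := ξ.push_spec b
  refine ⟨t ≫ sq.desc c η.m hb, ?_⟩
  have : sq.desc c η.m hb ≫ η.p = (ξ.push b).p ≫ f := by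
    apply sq.hom_ext
    · simp [hf, reassoc_of% hd]
    · simp [η.zero, reassoc_of% (ξ.push b).zero]
  rw [Category.assoc, this, reassoc_of% ht]

/-! ### Perpendicular classes and sums of ideals -/

variable (E)

theorem leftPerp_isIdeal (M : MorphismProperty C) : IsIdeal (E.leftPerp M) where
  zero_mem _ _ _ _ _ _ := extOrthogonal_iff_lifts.2 fun _ => ⟨0, by simp⟩
  add_mem f g hf hg _ _ b hb := extOrthogonal_iff_lifts.2 fun ξ => by
    obtain ⟨s, hs⟩ := extOrthogonal_iff_lifts.1 (hf b hb) ξ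
    obtain ⟨t, ht⟩ := extOrthogonal_iff_lifts.1 (hg b hb) ξ
    exact ⟨s + t, by simp [hs, ht]⟩
  neg_mem f hf _ _ b hb := extOrthogonal_iff_lifts.2 fun ξ => by
    obtain ⟨s, hs⟩ := extOrthogonal_iff_lifts.1 (hf b hb) ξ
    exact ⟨-s, by simp [hs]⟩
  comp_mem h g f hg _ _ b hb := extOrthogonal_iff_lifts.2 fun ξ => by
    obtain ⟨c, sq, hc⟩ := ξ.pull_spec f
    obtain ⟨d, sq', hd⟩ := ξ.push_spec b
    obtain ⟨t, ht⟩ := (hg b hb).exists_lift (ξ := ξ.pull f) (η := ξ.push b) (c := c ≫ d) (f := f)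
      (by rw [reassoc_of% hc, sq'.w]) (by rw [Category.assoc, hd, sq.w])
    exact ⟨h ≫ t, by rw [Category.assoc, ht]⟩

theorem rightPerp_isIdeal (M : MorphismProperty C) : IsIdeal (E.rightPerp M) where
  zero_mem _ _ _ _ _ _ := extOrthogonal_iff_extends.2 fun _ => ⟨0, by simp⟩
  add_mem f g hf hg _ _ a ha := extOrthogonal_iff_extends.2 fun ξ => by
    obtain ⟨s, hs⟩ := extOrthogonal_iff_extends.1 (hf a ha) ξ
    obtain ⟨t, ht⟩ := extOrthogonal_iff_extends.1 (hg a ha) ξ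
    exact ⟨s + t, by simp [hs, ht]⟩
  neg_mem f hf _ _ a ha := extOrthogonal_iff_extends.2 fun ξ => by
    obtain ⟨s, hs⟩ := extOrthogonal_iff_extends.1 (hf a ha) ξ
    exact ⟨-s, by simp [hs]⟩
  comp_mem h g f hg _ _ a ha := extOrthogonal_iff_extends.2 fun ξ => by
    obtain ⟨c, sq, hc⟩ := ξ.pull_spec a
    obtain ⟨d, sq', hd⟩ := ξ.push_spec h
    obtain ⟨e, sq'', he⟩ := (ξ.push h).pull_spec a
    obtain ⟨r, hr⟩ := extOrthogonal_iff_extends.1 (hg a ha) (ξ.push h)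
    let l : (ξ.pull a).mid ⟶ ((ξ.push h).pull a).mid :=
      sq''.lift (c ≫ d) (ξ.pull a).p (by rw [Category.assoc, hd, sq.w])
    have hl : (ξ.pull a).m ≫ l = h ≫ ((ξ.push h).pull a).m := by
      apply sq''.hom_ext
      · simp [l, reassoc_of% hc, he, sq'.w]
      · simp [l, Extension.zero]
    exact ⟨l ≫ r ≫ f, by rw [reassoc_of% hl, reassoc_of% hr]⟩

theorem rightPerp_leftPerp_rightPerp (M : MorphismProperty C) :
    E.rightPerp (E.leftPerp (E.rightPerp M)) = E.rightPerp M :=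
  le_antisymm (fun _ _ _ hb _ _ a ha => hb a fun _ _ _ hb' => hb' a ha)
    (fun _ _ b hb _ _ _ ha => ha b hb)

/-- The left perpendicular of the intersection is an ideal containing every `I j`, so it contains
their finite sums. -/
theorem rightPerp_idealSum {J : Type w} (I : J → MorphismProperty C) :
    E.rightPerp (idealSum I) = ⨅ j, E.rightPerp (I j) := by
  apply le_antisymm
  · exact le_iInf fun j _ _ b hb _ _ a ha => hb a (AddSubgroup.subset_closure ⟨j, ha⟩)
  · intro B₀ B₁ b hb A₀ A₁ a ha
    have hI := E.leftPerp_isIdeal (⨅ j, E.rightPerp (I j))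
    refine AddSubgroup.closure_induction (p := fun a _ => E.leftPerp (⨅ j, E.rightPerp (I j)) a)
      ?_ (hI.zero_mem _ _) (fun f g _ _ => hI.add_mem f g) (fun f _ => hI.neg_mem f) ha b hb
    rintro a ⟨j, ha⟩ X Y d hd
    exact iInf_le (fun j => E.rightPerp (I j)) j _ hd a ha

/-! ### Special precovers and special preenvelopes -/

variable {E}

/-- Salce's lemma for ideals. -/
theorem IsSpecialPreenveloping.isSpecialPrecovering_leftPerp (hproj : E.EnoughProjectiveMorphisms)
    {J : MorphismProperty C} (hJ : E.IsSpecialPreenveloping J) :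
    E.IsSpecialPrecovering (E.leftPerp J) := by
  intro A
  obtain ⟨P, p, hp, K, k, hkp, hk⟩ := hproj A
  let π : E.Extension A K := ⟨P, k, p, hkp, hk⟩
  obtain ⟨C₀, j, hj, A₀, C₁, A₁, p₀, m₁, p₁, h₀, h₁, c, a, conf₀, conf₁, hjc, hca, ha⟩ := hJ K
  let ε₁ : E.Extension A₁ K := ⟨C₁, m₁, p₁, h₁, conf₁⟩
  -- The precover will be `χ.p`. It factors as `w ≫ i` through `θ.mid`, while `w ≫ θ.p` factors
  -- through `a`.
  obtain ⟨χ, u, sq, hu⟩ := π.exists_push j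
  obtain ⟨θ, v, sq', hv⟩ := ε₁.exists_push k
  replace sq : IsPushout k j u χ.m := sq
  replace hu : u ≫ χ.p = p := hu
  replace sq' : IsPushout m₁ k v θ.m := sq'
  replace hv : v ≫ θ.p = p₁ := hv
  let i : θ.mid ⟶ A := sq'.desc 0 p (by simp [hkp])
  have hvi : v ≫ i = 0 := sq'.inl_desc _ _ _
  have hθi : θ.m ≫ i = p := sq'.inr_desc _ _ _
  let w : χ.mid ⟶ θ.mid := sq.desc θ.m (c ≫ v) (by rw [reassoc_of% hjc, sq'.w])
  have huw : u ≫ w = θ.m := sq.inl_desc _ _ _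
  have hχw : χ.m ≫ w = c ≫ v := sq.inr_desc _ _ _
  let z : χ.mid ⟶ A₀ := sq.desc 0 p₀ (by simp [h₀])
  have huz : u ≫ z = 0 := sq.inl_desc _ _ _
  have hχz : χ.m ≫ z = p₀ := sq.inr_desc _ _ _
  have hwi : w ≫ i = χ.p := by
    apply sq.hom_ext
    · rw [reassoc_of% huw, hθi, hu]
    · rw [reassoc_of% hχw, hvi, comp_zero, χ.zero]
  have hza : z ≫ a = w ≫ θ.p := by
    apply sq.hom_ext
    · rw [reassoc_of% huz, reassoc_of% huw, zero_comp, θ.zero]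
    · rw [reassoc_of% hχz, reassoc_of% hχw, hv, hca]
  refine ⟨χ.mid, χ.p, ?_, K, P, C₀, k, p, χ.m, hkp, χ.zero, j, u, hk, χ.conf, sq.w, hu,
    fun _ _ a ha => ha j hj⟩
  intro B₀ B₁ g hg
  rw [extOrthogonal_iff_lifts]
  intro ξ
  obtain ⟨d, sqd, hd⟩ := ξ.push_spec g
  obtain ⟨ξ', e, sqe, he⟩ := ξ.exists_pull i
  -- Tested against an identity, projectivity says that `p` lifts along every deflation onto `A`.
  -- Hence `θ.m` lifts to the pullback `ξ'` of `ξ` along `i`, and `ξ'` comes from an extension `ζ`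
  -- of `A₁`.
  obtain ⟨t, ht⟩ := (hp (𝟙 B₀)).exists_lift (ξ := ξ) (η := ξ) (c := 𝟙 _) (f := 𝟙 _)
    (by simp) (by simp)
  rw [Category.comp_id] at ht
  obtain ⟨ζ, f, hζ, hf⟩ := θ.exists_of_lifts ξ' (sqe.lift t θ.m (by rw [ht, hθi]))
    (sqe.lift_snd _ _ _)
  obtain ⟨ξ'', e', sqe', he'⟩ := ξ'.exists_pull w
  obtain ⟨d', sqd', hd'⟩ := ζ.push_spec g
  obtain ⟨t', ht'⟩ := extOrthogonal_iff_lifts.1 (ha g hg) ζ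
  -- Pulling `ξ` back along `w ≫ i` amounts to pulling `ζ` back along `w ≫ θ.p = z ≫ a`, and `a` is
  -- orthogonal to `g`.
  have hext : ∃ r : ξ''.mid ⟶ B₁, ξ''.m ≫ r = g :=
    (Extension.lifts_iff_extends (η := ζ.push g) (c := e' ≫ f ≫ d') (a := w ≫ θ.p)
      (by rw [reassoc_of% he', reassoc_of% hζ, sqd'.w])
      (by rw [Category.assoc, Category.assoc, hd', hf, sqe'.w_assoc])).1
      ⟨z ≫ t', by rw [Category.assoc, ht', hza]⟩
  exact (Extension.lifts_iff_extends (ξ := ξ'') (b := g) (c := e' ≫ e ≫ d)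
    (by rw [reassoc_of% he', reassoc_of% he, sqd.w])
    (by rw [Category.assoc, Category.assoc, hd, sqe.w, sqe'.w_assoc, hwi])).2 hext

/-- Left perpendicular classes are closed under coproducts. -/
theorem leftPerp_sigmaMap {ι : Type w} (M : MorphismProperty C) {X Y : ι → C}
    [HasCoproduct X] [HasCoproduct Y] (a : ∀ i, X i ⟶ Y i) (ha : ∀ i, E.leftPerp M (a i)) :
    E.leftPerp M (Limits.Sigma.map a) := by
  intro B₀ B₁ b hb
  rw [extOrthogonal_iff_lifts]
  intro ξ
  obtain ⟨d, sq, hd⟩ := ξ.push_spec b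
  have (i : ι) : ∃ t : X i ⟶ (ξ.push b).mid,
      t ≫ (ξ.push b).p = a i ≫ Limits.Sigma.ι Y i := by
    obtain ⟨e, sqe, he⟩ := ξ.pull_spec (Limits.Sigma.ι Y i)
    exact (ha i b hb).exists_lift (ξ := ξ.pull _) (c := e ≫ d)
      (by rw [reassoc_of% he, sq.w]) (by rw [Category.assoc, hd, sqe.w])
  choose t ht using this
  exact ⟨Limits.Sigma.desc t, by ext i; simp [ht]⟩

theorem isSpecialPreenveloping_iInf (hE : HasExactCoproducts.{w} E) {ι : Type w}
    (J : ι → MorphismProperty C) (hideal : ∀ i, IsIdeal (J i))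
    (hJ : ∀ i, E.IsSpecialPreenveloping (J i)) : E.IsSpecialPreenveloping (⨅ i, J i) := by
  have := hE.hasCoproducts
  intro B
  choose C₀ j hj A₀ C₁ A₁ p₀ m₁ p₁ h₀ h₁ c a conf₀ conf₁ hjc hca ha using fun i => hJ i B
  let σ₀ : E.Extension (∐ A₀) (∐ fun _ : ι => B) :=
    ⟨∐ C₀, Limits.Sigma.map j, Limits.Sigma.map p₀, by ext i; simp [reassoc_of% h₀],
      hE.conflation_coproduct (fun i => ShortComplex.mk (j i) (p₀ i) (h₀ i)) conf₀⟩
  let σ₁ : E.Extension (∐ A₁) (∐ fun _ : ι => B) :=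
    ⟨∐ C₁, Limits.Sigma.map m₁, Limits.Sigma.map p₁, by ext i; simp [reassoc_of% h₁],
      hE.conflation_coproduct (fun i => ShortComplex.mk (m₁ i) (p₁ i) (h₁ i)) conf₁⟩
  let δ : (∐ fun _ : ι => B) ⟶ B := Limits.Sigma.desc fun _ => 𝟙 B
  obtain ⟨η₀, d₀, sq₀, hd₀⟩ := σ₀.exists_push δ
  obtain ⟨η₁, d₁, sq₁, hd₁⟩ := σ₁.exists_push δ
  replace sq₀ : IsPushout (Limits.Sigma.map j) δ d₀ η₀.m := sq₀
  replace sq₁ : IsPushout (Limits.Sigma.map m₁) δ d₁ η₁.m := sq₁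
  replace hd₀ : d₀ ≫ η₀.p = Limits.Sigma.map p₀ := hd₀
  replace hd₁ : d₁ ≫ η₁.p = Limits.Sigma.map p₁ := hd₁
  have hmap : Limits.Sigma.map j ≫ Limits.Sigma.map c = Limits.Sigma.map m₁ := by
    ext i; simp [reassoc_of% hjc]
  let e : η₀.mid ⟶ η₁.mid := sq₀.desc (Limits.Sigma.map c ≫ d₁) η₁.m
    (by rw [reassoc_of% hmap, sq₁.w])
  have hde : d₀ ≫ e = Limits.Sigma.map c ≫ d₁ := sq₀.inl_desc _ _ _
  have hme : η₀.m ≫ e = η₁.m := sq₀.inr_desc _ _ _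
  refine ⟨η₀.mid, η₀.m, ?_, _, η₁.mid, _, η₀.p, η₁.m, η₁.p, η₀.zero, η₁.zero, e,
    Limits.Sigma.map a, η₀.conf, η₁.conf, hme, ?_, leftPerp_sigmaMap _ a fun i => ?_⟩
  · rw [MorphismProperty.iInf_iff]
    intro i
    -- Restricting the pushout square to the summand `i`, where the codiagonal is the identity,
    -- exhibits `η₀.m` as a multiple of `j i`.
    have hw : 𝟙 B ≫ j i ≫ Limits.Sigma.ι C₀ i ≫ d₀ = η₀.m := by
      have := Limits.Sigma.ι (fun _ : ι => B) i ≫= sq₀.w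
      simpa [δ] using this
    rw [← hw]
    exact (hideal i).comp_mem _ _ _ (hj i)
  · apply sq₀.hom_ext
    · rw [reassoc_of% hd₀, reassoc_of% hde, hd₁]
      ext i; simp [reassoc_of% hca]
    · rw [reassoc_of% η₀.zero, reassoc_of% hme, η₁.zero, zero_comp]
  · exact fun _ _ b hb => ha i b (iInf_le J i _ hb)

end ExactStructure

end IdealApprox

theorem corollaryC {C : Type u} [Category.{v} C] [Preadditive C] [HasZeroObject C]
    [HasBinaryBiproducts C]
    (E : IdealApprox.ExactStructure C)
    (hcoprod : IdealApprox.ExactStructure.HasExactCoproducts.{w} E)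
    (hinj : E.EnoughInjectiveMorphisms) (hproj : E.EnoughProjectiveMorphisms)
    {J : Type w} (I : J → MorphismProperty C)
    (hI : ∀ j, E.IsCompleteCotorsionPair (I j) (E.rightPerp (I j))) :
    E.IsCompleteCotorsionPair (E.leftPerp (⨅ j, E.rightPerp (I j))) (⨅ j, E.rightPerp (I j)) ∧
      E.leftPerp (⨅ j, E.rightPerp (I j)) = E.leftClosure (IdealApprox.idealSum I) := by
  have hJ : E.IsSpecialPreenveloping (⨅ j, E.rightPerp (I j)) :=
    IdealApprox.ExactStructure.isSpecialPreenveloping_iInf hcoprod _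
      (fun j => E.rightPerp_isIdeal (I j)) fun j => (hI j).isSpecialPreenveloping
  have hsum := E.rightPerp_idealSum I
  refine ⟨⟨⟨E.leftPerp_isIdeal _, ?_, rfl, ?_⟩, hJ.isSpecialPrecovering_leftPerp hproj, hJ⟩, ?_⟩
  · exact hsum ▸ E.rightPerp_isIdeal _
  · rw [← hsum, E.rightPerp_leftPerp_rightPerp]
  · rw [← hsum]
    rfl
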